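/- For a sequence $S=(s_1,\dots,s_k)$ of positive integers, an $S$-packing coloring of a set $A$ of vertices of a graph $G$ is a map $c:A\to\{1,\dots,k\}$ such that any two distinct vertices $u,v\in A$ with $c(u)=c(v)=i$ satisfy $d_G(u,v)>s_i$; it is an $S$-packing coloring of $G$ if $A=V(G)$. The packing chromatic number $\chi_\rho(G)$ is the least $k$ such that $G$ has a $(1,2,\dots,k)$-packing coloring. **Proposition.** There exists a cubic graph with packing chromatic number $13$. More precisely, there is a connected cubic simple graph $G$ with $38$ vertices and diameter $4$ such that every set of vertices of $G$ that admits a $(1,2,3)$-packing coloring (with distances measured in $G$) has at most $28$ elements, and $\chi_\rho(G)=13$. -/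

import Mathlib

namespace PackingColoring

variable {V : Type*}

/-- A cubic graph: every vertex has exactly three neighbours. -/
def IsCubic (G : SimpleGraph V) : Prop :=
  ∀ v : V, (G.neighborSet v).ncard = 3

/-- `c` is an `S`-packing coloring of the vertices in `A`, for the sequence
`S = (s_0, …, s_{k-1})`: two distinct vertices of `A` that receive the same color `i` are at
distance greater than `s_i` in `G` (the distance is `⊤` between different components). The colors
are the indices, so that repeated values of the sequence are different colors. The values of `c`
outside `A` play no role. -/
def IsSPackingColoringOn (G : SimpleGraph V) {k : ℕ} (S : Fin k → ℕ) (A : Set V)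
    (c : V → Fin k) : Prop :=
  ∀ u ∈ A, ∀ v ∈ A, u ≠ v → c u = c v → (S (c u) : ℕ∞) < G.edist u v

/-- `c` is an `S`-packing coloring of `G`. -/
def IsSPackingColoring (G : SimpleGraph V) {k : ℕ} (S : Fin k → ℕ) (c : V → Fin k) : Prop :=
  IsSPackingColoringOn G S Set.univ c

/-- `G` is `S`-colorable. -/
def SColorable (G : SimpleGraph V) {k : ℕ} (S : Fin k → ℕ) : Prop :=
  ∃ c : V → Fin k, IsSPackingColoring G S c

/-- `G` is `S`-chromatic: it is `S`-colorable, but not colorable for any proper prefix of `S`. -/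
def SChromatic (G : SimpleGraph V) {k : ℕ} (S : Fin k → ℕ) : Prop :=
  SColorable G S ∧
    ∀ (j : ℕ) (hj : j < k), ¬ SColorable G (fun i : Fin j => S (Fin.castLE hj.le i))

/-- The sequence `(1, 2, …, k)`. -/
def oneTo (k : ℕ) : Fin k → ℕ := fun i => (i : ℕ) + 1

/-- The packing chromatic number: the least `k` such that `G` is `(1, 2, …, k)`-colorable
(`⊤` if there is none). -/
noncomputable def packingChromaticNumber (G : SimpleGraph V) : ℕ∞ :=
  ⨅ k ∈ {k : ℕ | SColorable G (oneTo k)}, (k : ℕ∞)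

/-- The packing chromatic number is the integer `k` for which `G` is `(1, …, k)`-chromatic. -/
theorem packingChromaticNumber_eq_iff (G : SimpleGraph V) (k : ℕ) :
    packingChromaticNumber G = k ↔ SChromatic G (oneTo k) := by
  have key : ∀ m : ℕ, (∃ j ∈ {j : ℕ | SColorable G (oneTo j)}, j ≤ m) ↔
      packingChromaticNumber G ≤ m := by
    intro m
    constructor
    · rintro ⟨j, hj, hjm⟩
      exact (iInf₂_le j hj).trans (by exact_mod_cast hjm)
    · intro h
      by_contra! hcon
      have : ((m + 1 : ℕ) : ℕ∞) ≤ packingChromaticNumber G :=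
        le_iInf₂ fun j hj => by exact_mod_cast hcon j hj
      have h2 : m + 1 ≤ m := by exact_mod_cast this.trans h
      omega
  constructor
  · intro h
    have hlow : ∀ j < k, ¬ SColorable G (oneTo j) := by
      intro j hj hc
      have h1 := (key j).1 ⟨j, hc, le_rfl⟩
      rw [h] at h1
      have : k ≤ j := by exact_mod_cast h1
      omega
    obtain ⟨j, hj, hjk⟩ := (key k).2 h.le
    have : j = k := by
      by_contra hne
      exact hlow j (by omega) hj
    subst this
    exact ⟨hj, fun i hi => hlow i hi⟩
  · rintro ⟨hc, hlow⟩
    refine le_antisymm ((key k).1 ⟨k, hc, le_rfl⟩) (le_iInf₂ fun j hj => ?_)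
    by_contra hlt
    have hjk : j < k := by
      by_contra hge
      exact hlt (by exact_mod_cast not_lt.1 hge)
    exact hlow j hjk hj

end PackingColoring

namespace PackingColoring

/-! Since the diameter is 4, each color of value at least 4 occurs at most once. If colors 1, 2, 3
cover at most 28 vertices, at least 10 further colors are needed, and an explicit coloring attains
13. The bound 28 is 23 + 5: color 3 has at most 5 vertices, and colors 1 and 2 together at most 23
(`card_add_card_le`). Cover the vertices by cells of diameter at most `k`. A set with pairwise
distances above `k` meets each cell at most once, so a large one misses few cells. A search over the
choices in each cell, with a budget of missed cells, excludes it. -/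

/-! ### The graph and its distances -/

/-- The three neighbours of each vertex of the graph of order 38 and diameter 4. -/
def nbrTable : List (List ℕ) :=
  [[21, 33, 34], [3, 31, 32], [8, 11, 14], [1, 24, 36], [5, 8, 31], [4, 20, 21], [9, 20, 36],
  [9, 26, 34], [2, 4, 23], [6, 7, 23], [16, 35, 36], [2, 16, 29], [15, 29, 32], [16, 17, 22],
  [2, 24, 27], [12, 20, 37], [10, 11, 13], [13, 19, 37], [25, 30, 32], [17, 30, 33], [5, 6, 15],
  [0, 5, 35], [13, 26, 31], [8, 9, 30], [3, 14, 33], [18, 28, 35], [7, 22, 28], [14, 28, 37],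
  [25, 26, 27], [11, 12, 34], [18, 19, 23], [1, 4, 22], [1, 12, 18], [0, 19, 24], [0, 7, 29],
  [10, 21, 25], [3, 6, 10], [15, 17, 27]]

/-- The neighbours of the vertex `u`. -/
def nbrs (u : ℕ) : List ℕ := nbrTable.getD u []

theorem mem_nbrs_comm : ∀ u v : Fin 38, (v : ℕ) ∈ nbrs u → (u : ℕ) ∈ nbrs v := by
  decide +kernel

theorem not_mem_nbrs_self : ∀ u : Fin 38, (u : ℕ) ∉ nbrs u := by
  decide +kernel

theorem lt_of_mem_nbrs : ∀ u : Fin 38, ∀ w ∈ nbrs u, w < 38 := by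
  decide +kernel

/-- A cubic graph with 38 vertices and diameter 4. -/
def graph38 : SimpleGraph (Fin 38) where
  Adj u v := (v : ℕ) ∈ nbrs u
  symm := ⟨mem_nbrs_comm⟩
  loopless := ⟨not_mem_nbrs_self⟩

instance : DecidableRel graph38.Adj := fun u v =>
  inferInstanceAs (Decidable ((v : ℕ) ∈ nbrs u))

theorem isCubic_graph38 : IsCubic graph38 := by
  have h : ∀ v : Fin 38, (Finset.univ.filter fun w => graph38.Adj v w).card = 3 := by
    decide +kernel
  intro v
  rw [← h v, ← Set.ncard_coe_finset]
  congr 1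
  ext w
  simp

/-- Splitting off the first edge of a shortest walk gives the recursion that `ball` follows. -/
theorem edist_le_succ_iff {V : Type*} (G : SimpleGraph V) (u v : V) (n : ℕ) :
    G.edist u v ≤ (n + 1 : ℕ) ↔ u = v ∨ ∃ w, G.Adj u w ∧ G.edist w v ≤ n := by
  constructor
  · intro h
    have hr : G.Reachable u v := by
      rw [← SimpleGraph.edist_ne_top_iff_reachable]
      exact ne_top_of_le_ne_top (ENat.natCast_ne_top _) h
    obtain ⟨p, hp⟩ := hr.exists_walk_length_eq_edist
    cases p with
    | nil => exact Or.inl rfl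
    | cons hadj q =>
      refine Or.inr ⟨_, hadj, (SimpleGraph.edist_le q).trans ?_⟩
      rw [← hp, SimpleGraph.Walk.length_cons, Nat.cast_le] at h
      exact_mod_cast Nat.le_of_succ_le_succ h
  · rintro (rfl | ⟨w, hadj, hw⟩)
    · simp
    · calc G.edist u v ≤ G.edist u w + G.edist w v := SimpleGraph.edist_triangle
        _ ≤ 1 + n := add_le_add (SimpleGraph.edist_eq_one_iff_adj.2 hadj).le hw
        _ = ((n + 1 : ℕ) : ℕ∞) := by push_cast; exact add_comm _ _

/-- The ball of radius `n` around `u`, as a bit mask. -/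
def ball : ℕ → ℕ → ℕ
  | 0, u => 2 ^ u
  | n + 1, u => (nbrs u).foldl (fun m w => m ||| ball n w) (2 ^ u)

theorem testBit_foldl_lor (f : ℕ → ℕ) (l : List ℕ) (m i : ℕ) :
    (l.foldl (fun m w => m ||| f w) m).testBit i = true ↔
      m.testBit i = true ∨ ∃ w ∈ l, (f w).testBit i = true := by
  induction l generalizing m with
  | nil => simp
  | cons a l ih => simp [ih, Nat.testBit_or, or_assoc]

theorem testBit_ball (n : ℕ) (u v : Fin 38) :
    (ball n u).testBit v = true ↔ graph38.edist u v ≤ n := by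
  induction n generalizing u with
  | zero => simp [ball, Nat.testBit_two_pow, Fin.ext_iff]
  | succ n ih =>
    rw [edist_le_succ_iff, ball, testBit_foldl_lor, Nat.testBit_two_pow, decide_eq_true_iff,
      Fin.ext_iff]
    refine or_congr Iff.rfl ⟨?_, ?_⟩
    · rintro ⟨w, hw, h⟩
      exact ⟨⟨w, lt_of_mem_nbrs u w hw⟩, hw, (ih ⟨w, _⟩).1 h⟩
    · rintro ⟨w, hw, h⟩
      exact ⟨w, hw, (ih w).2 h⟩

theorem edist_graph38_le (u v : Fin 38) : graph38.edist u v ≤ 4 := by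
  have h : ∀ u v : Fin 38, (ball 4 u).testBit v = true := by decide +kernel
  exact_mod_cast (testBit_ball 4 u v).1 (h u v)

theorem connected_graph38 : graph38.Connected where
  preconnected u v := by
    rw [← SimpleGraph.edist_ne_top_iff_reachable]
    exact ne_top_of_le_ne_top (ENat.natCast_ne_top 4) (edist_graph38_le u v)

theorem ediam_graph38 : graph38.ediam = 4 := by
  refine le_antisymm (SimpleGraph.ediam_le_of_edist_le edist_graph38_le) ?_
  have h : ∃ u v : Fin 38, (ball 3 u).testBit v = false := by decide +kernel
  obtain ⟨u, v, h⟩ := h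
  refine le_trans ?_ (SimpleGraph.edist_le_ediam (u := u) (v := v))
  have h3 : ¬ graph38.edist u v ≤ (3 : ℕ) := by
    rw [← testBit_ball, h]
    exact Bool.false_ne_true
  exact Order.add_one_le_of_lt (not_le.1 h3)

/-! ### Exhaustive search over cells -/

/-- Refutation of the existence of a set that meets all but at most `s` of the cells, in at least
one vertex each, and is compatible with the choices made so far. The entries of a cell are pairs of
a vertex and the bit mask of the vertices excluded by its choice; `f` is the mask of the excluded
vertices and `u` that of the chosen ones. When the cells are exhausted, `leaf` is asked. -/
def refute (leaf : ℕ → ℕ → Bool) : List (List (ℕ × ℕ)) → ℕ → ℕ → ℕ → Bool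
  | [], s, _, u => leaf s u
  | c :: cs, s, f, u =>
    (match s with
      | 0 => true
      | s + 1 => refute leaf cs s f u) &&
    c.all fun p => f.testBit p.1 || refute leaf cs s (f ||| p.2) (u ||| 2 ^ p.1)

/-- The number of cells that meet `S`. -/
def hits (S : Finset ℕ) (cs : List (List (ℕ × ℕ))) : ℕ :=
  cs.countP fun c => c.any fun p => decide (p.1 ∈ S)

/-- `S` itself traces a branch of the search: take a vertex of `S` where the cell has one, skip
otherwise. The branch is never pruned, and each skip costs one unit of slack, whence the final
equation. -/
theorem exists_leaf_of_refute {leaf : ℕ → ℕ → Bool} {S : Finset ℕ} {cs : List (List (ℕ × ℕ))}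
    (hcs : ∀ c ∈ cs, ∀ p ∈ c, p.1 ∈ S → ∀ w ∈ S, p.2.testBit w = false) {s f u : ℕ}
    (h : refute leaf cs s f u = true) (hf : ∀ w ∈ S, f.testBit w = false)
    (hu : ∀ w, u.testBit w = true → w ∈ S) (hs : cs.length ≤ s + hits S cs) :
    ∃ s' u', leaf s' u' = true ∧ (∀ w, u'.testBit w = true → w ∈ S) ∧
      s' + cs.length = s + hits S cs := by
  induction cs generalizing s f u with
  | nil => exact ⟨s, u, h, hu, by simp [hits]⟩
  | cons c cs ih =>
    have hcs' : ∀ c ∈ cs, ∀ p ∈ c, p.1 ∈ S → ∀ w ∈ S, p.2.testBit w = false :=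
      fun d hd => hcs d (List.mem_cons_of_mem _ hd)
    rw [refute.eq_def, Bool.and_eq_true, List.all_eq_true] at h
    by_cases hc : ∃ p ∈ c, p.1 ∈ S
    · obtain ⟨p, hp, hpS⟩ := hc
      have hh : hits S (c :: cs) = hits S cs + 1 :=
        List.countP_cons_of_pos (by simpa using ⟨p.1, ⟨p.2, hp⟩, hpS⟩)
      rw [hh, List.length_cons] at hs ⊢
      have h2 := h.2 p hp
      rw [hf _ hpS, Bool.false_or] at h2
      obtain ⟨s', u', h3, h4, h5⟩ := ih hcs' h2
        (fun w hw => by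
          rw [Nat.testBit_or, hf w hw, hcs c List.mem_cons_self p hp hpS w hw, Bool.or_false])
        (fun w hw => by
          rw [Nat.testBit_or, Bool.or_eq_true, Nat.testBit_two_pow, decide_eq_true_iff] at hw
          rcases hw with hw | rfl
          · exact hu w hw
          · exact hpS) (by omega)
      exact ⟨s', u', h3, h4, by omega⟩
    · have hh : hits S (c :: cs) = hits S cs :=
        List.countP_cons_of_neg (by simpa using fun a b hab hS => hc ⟨(a, b), hab, hS⟩)
      rw [hh, List.length_cons] at hs ⊢
      have hle : hits S cs ≤ cs.length := List.countP_le_length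
      -- A missed cell forces positive slack, so the branch `s = 0` cannot occur here.
      obtain ⟨s, rfl⟩ : ∃ t, s = t + 1 := ⟨s - 1, by omega⟩
      obtain ⟨s', u', h3, h4, h5⟩ := ih hcs' h.1 hf hu (by omega)
      exact ⟨s', u', h3, h4, by omega⟩

theorem card_le_hits {S : Finset ℕ} {cs : List (List (ℕ × ℕ))}
    (hcs : ∀ c ∈ cs, ∀ p ∈ c, p.1 ∈ S → ∀ w ∈ S, p.2.testBit w = false)
    (hclique : ∀ c ∈ cs, ∀ p ∈ c, ∀ q ∈ c, p.1 = q.1 ∨ p.2.testBit q.1 = true)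
    (hcover : ∀ v ∈ S, ∃ c ∈ cs, ∃ p ∈ c, p.1 = v) : S.card ≤ hits S cs := by
  suffices h : ∀ ds : List (List (ℕ × ℕ)), (∀ d ∈ ds, d ∈ cs) →
      (S.filter fun v => ∃ c ∈ ds, ∃ p ∈ c, p.1 = v).card ≤ hits S ds by
    have := h cs fun _ h => h
    rwa [Finset.filter_true_of_mem hcover] at this
  intro ds
  induction ds with
  | nil => simp
  | cons c ds ih =>
    intro hds
    have ih' := ih fun d hd => hds d (List.mem_cons_of_mem _ hd)
    have hc := hds c List.mem_cons_self
    have hsplit : (S.filter fun v => ∃ d ∈ c :: ds, ∃ p ∈ d, p.1 = v) =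
        (S.filter fun v => ∃ p ∈ c, p.1 = v) ∪
          S.filter fun v => ∃ d ∈ ds, ∃ p ∈ d, p.1 = v := by
      ext v
      simp only [Finset.mem_filter, Finset.mem_union, List.mem_cons,
        exists_eq_or_imp, and_or_left]
    rw [hsplit]
    refine (Finset.card_union_le _ _).trans ?_
    by_cases hm : ∃ p ∈ c, p.1 ∈ S
    · rw [hits, List.countP_cons_of_pos (by
        obtain ⟨p, hp, hpS⟩ := hm
        simpa using ⟨p.1, ⟨p.2, hp⟩, hpS⟩), ← hits, add_comm]
      refine add_le_add ih' (Finset.card_le_one.2 ?_)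
      intro a ha b hb
      rw [Finset.mem_filter] at ha hb
      obtain ⟨haS, p, hp, rfl⟩ := ha
      obtain ⟨hbS, q, hq, rfl⟩ := hb
      refine (hclique c hc p hp q hq).resolve_right fun h => ?_
      rw [hcs c hc p hp haS _ hbS] at h
      exact Bool.false_ne_true h
    · rw [hits, List.countP_cons_of_neg (by
        simpa using fun a b hab hS => hm ⟨(a, b), hab, hS⟩), ← hits]
      rw [Finset.filter_false_of_mem, Finset.card_empty, zero_add]
      · exact ih'
      · rintro _ hv ⟨p, hp, rfl⟩
        exact hm ⟨p, hp, hv⟩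

/-- Attach to each vertex the mask of the other vertices at distance at most `k`. -/
def withMasks (k : ℕ) (l : List (List ℕ)) : List (List (ℕ × ℕ)) :=
  l.map (List.map fun v => (v, ball k v ^^^ 2 ^ v))

/-! ### Cell covers and packings -/

/-- A perfect matching. -/
def cells1 : List (List ℕ) :=
  [[0, 33], [34, 7], [19, 30], [23, 8], [9, 6], [4, 5], [20, 15], [29, 12], [21, 35], [36, 10],
  [18, 25], [26, 28], [31, 22], [32, 1], [27, 37], [13, 17], [2, 14], [11, 16], [24, 3]]

/-- A partition into sets of diameter at most 2. -/
def cells2 : List (List ℕ) :=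
  [[9], [18, 25, 30], [2, 4, 8, 23], [14, 24, 27], [1, 3, 31, 32], [7, 22, 26, 28], [11, 12, 29],
  [0, 21, 33, 34], [10, 16, 35, 36], [13, 17, 19, 37], [5, 6, 15, 20]]

/-- A partition into sets of diameter at most 3. -/
def cells3 : List (List ℕ) :=
  [[1, 3, 4, 32], [0, 9, 29, 34], [5, 6, 12, 15, 20, 37], [2, 8, 11, 14, 24, 27],
  [17, 18, 19, 23, 30, 33], [7, 13, 22, 26, 28, 31], [10, 16, 21, 25, 35, 36]]

/-- `l` covers the vertices by sets of diameter at most `k`. -/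
def IsCellCover (k : ℕ) (l : List (List ℕ)) : Prop :=
  (∀ v < 38, ∃ c ∈ l, v ∈ c) ∧
    ∀ c ∈ l, ∀ v ∈ c, ∀ w ∈ c, v = w ∨ (ball k v ^^^ 2 ^ v).testBit w = true

instance (k : ℕ) (l : List (List ℕ)) : Decidable (IsCellCover k l) :=
  inferInstanceAs (Decidable (_ ∧ _))

theorem isCellCover_cells1 : IsCellCover 1 cells1 := by decide +kernel

theorem isCellCover_cells2 : IsCellCover 2 cells2 := by decide +kernel

theorem isCellCover_cells3 : IsCellCover 3 cells3 := by decide +kernel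

/-- The vertices in `S` are pairwise at distance more than `k`. -/
def IsPacking (k : ℕ) (S : Finset (Fin 38)) : Prop :=
  ∀ u ∈ S, ∀ v ∈ S, u ≠ v → (k : ℕ∞) < graph38.edist u v

theorem withMasks_spec {k : ℕ} (l : List (List ℕ))
    {S : Finset (Fin 38)} (hS : IsPacking k S) :
    ∀ c ∈ withMasks k l, ∀ p ∈ c, p.1 ∈ S.map Fin.valEmbedding →
      ∀ w ∈ S.map Fin.valEmbedding, p.2.testBit w = false := by
  intro c hc p hp hpS w hw
  obtain ⟨c, -, rfl⟩ := List.mem_map.1 hc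
  obtain ⟨v, -, rfl⟩ := List.mem_map.1 hp
  obtain ⟨v, hvS, rfl⟩ := Finset.mem_map.1 hpS
  obtain ⟨w, hwS, rfl⟩ := Finset.mem_map.1 hw
  simp only [Fin.valEmbedding_apply, Nat.testBit_xor, Nat.testBit_two_pow]
  by_cases h : v = w
  · subst h
    rw [(testBit_ball k v v).2 (by simp)]
    simp
  · have h1 : (ball k v).testBit w = false := by
      rw [← Bool.not_eq_true, testBit_ball]
      exact not_le.2 (hS v hvS w hwS h)
    have h2 : (v : ℕ) ≠ w := fun h3 => h (Fin.ext h3)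
    simp [h1, h2]

theorem card_le_hits_withMasks {k : ℕ} {l : List (List ℕ)} (hl : IsCellCover k l)
    {S : Finset (Fin 38)} (hS : IsPacking k S) :
    S.card ≤ hits (S.map Fin.valEmbedding) (withMasks k l) := by
  rw [← Finset.card_map Fin.valEmbedding]
  refine card_le_hits (withMasks_spec l hS) ?_ ?_
  · intro c hc p hp q hq
    obtain ⟨c, hcl, rfl⟩ := List.mem_map.1 hc
    obtain ⟨v, hv, rfl⟩ := List.mem_map.1 hp
    obtain ⟨w, hw, rfl⟩ := List.mem_map.1 hq
    exact hl.2 c hcl v hv w hw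
  · intro v hv
    obtain ⟨v, -, rfl⟩ := Finset.mem_map.1 hv
    obtain ⟨c, hc, hvc⟩ := hl.1 v v.2
    exact ⟨_, List.mem_map_of_mem hc, _, List.mem_map_of_mem hvc, rfl⟩

/-- If the search started with slack `s` succeeds with a leaf that never refutes, then `S` has
fewer than `l.length - s` vertices. -/
theorem card_add_lt_of_refute {k : ℕ} {l : List (List ℕ)} (hl : IsCellCover k l)
    {S : Finset (Fin 38)} (hS : IsPacking k S) {s f : ℕ}
    (h : refute (fun _ _ => false) (withMasks k l) s f 0 = true)
    (hf : ∀ w ∈ S, f.testBit w = false) : S.card + s < l.length := by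
  by_contra! hlt
  have hle := card_le_hits_withMasks hl hS
  have hlen : (withMasks k l).length = l.length := List.length_map _
  obtain ⟨_, _, h, -⟩ := exists_leaf_of_refute (withMasks_spec l hS) h
    (fun w hw => by
      obtain ⟨v, hv, rfl⟩ := Finset.mem_map.1 hw
      exact hf v hv) (by simp) (by omega)
  exact Bool.false_ne_true h

/-! ### Bounds for the first three colors -/

theorem card_le_five_of_isPacking_three {S : Finset (Fin 38)} (hS : IsPacking 3 S) :
    S.card ≤ 5 := by
  have h : refute (fun _ _ => false) (withMasks 3 cells3) 1 0 0 = true := by decide +kernel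
  have := card_add_lt_of_refute isCellCover_cells3 hS h (by simp)
  simp only [cells3, List.length_cons, List.length_nil] at this
  omega

theorem card_le_eight_of_isPacking_two {S : Finset (Fin 38)} (hS : IsPacking 2 S) :
    S.card ≤ 8 := by
  have h : refute (fun _ _ => false) (withMasks 2 cells2) 2 0 0 = true := by decide +kernel
  have := card_add_lt_of_refute isCellCover_cells2 hS h (by simp)
  simp only [cells2, List.length_cons, List.length_nil] at this
  omega

/-- If |S| + |T| ≥ 24 and |T| ≤ 8, then S misses at most 3 of the 19 edges. With slack `s` left at a
leaf, |S| ≤ 16 + `s`, so |T| ≥ 8 - `s` and T misses at most `s + 3` of the 11 cells. T must avoid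
the chosen vertices `u`, which start the inner search as its excluded mask. -/
theorem refute_cells1_cells2 :
    refute (fun s u => refute (fun _ _ => false) (withMasks 2 cells2) (s + 3) u 0)
      (withMasks 1 cells1) 3 0 0 = true := by
  decide +kernel

theorem card_add_card_le {S T : Finset (Fin 38)} (hS : IsPacking 1 S) (hT : IsPacking 2 T)
    (hST : Disjoint S T) : S.card + T.card ≤ 23 := by
  by_contra! hlt
  have hT8 := card_le_eight_of_isPacking_two hT
  have hle := card_le_hits_withMasks isCellCover_cells1 hS
  have hlen : (withMasks 1 cells1).length = 19 := rfl
  obtain ⟨s, u, h, hu, hs⟩ := exists_leaf_of_refute (withMasks_spec cells1 hS)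
    refute_cells1_cells2 (by simp) (by simp) (by omega)
  have := card_add_lt_of_refute isCellCover_cells2 hT h fun w hw => by
    rw [← Bool.not_eq_true]
    intro hwu
    obtain ⟨v, hv, hvw⟩ := Finset.mem_map.1 (hu w hwu)
    obtain rfl : v = w := Fin.ext hvw
    exact Finset.disjoint_left.1 hST hv hw
  simp only [cells2, List.length_cons, List.length_nil] at this
  omega

theorem card_le_of_isSPackingColoringOn (A : Finset (Fin 38)) (c : Fin 38 → Fin 3)
    (h : IsSPackingColoringOn graph38 (oneTo 3) (A : Set (Fin 38)) c) : A.card ≤ 28 := by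
  have hp (i : Fin 3) : IsPacking (i + 1) (A.filter fun v => c v = i) := by
    intro u hu v hv huv
    rw [Finset.mem_filter] at hu hv
    have := h u hu.1 v hv.1 huv (hu.2.trans hv.2.symm)
    rwa [hu.2] at this
  have h12 := card_add_card_le (hp 0) (hp 1) (by
    rw [Finset.disjoint_filter]
    intro v _ h0 h1
    rw [h0] at h1
    exact absurd h1 (by decide))
  have h3 := card_le_five_of_isPacking_three (hp 2)
  have := Finset.card_eq_sum_card_fiberwise (f := c) (s := A) (t := Finset.univ)
    fun _ _ => Finset.mem_coe.2 (Finset.mem_univ _)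
  rw [Fin.sum_univ_three] at this
  omega

/-! ### The packing chromatic number -/

/-- The colors of a `(1, 2, …, 13)`-packing coloring, with 0 for the first color. -/
def colorTable : List ℕ :=
  [1, 0, 0, 3, 0, 4, 2, 5, 6, 0, 1, 2, 0, 7, 1, 8, 0, 1, 0, 0, 1, 0, 0, 1, 0, 2, 1, 9, 0, 10, 11, 2, 1, 2, 0, 12, 0, 0]

theorem sColorable_graph38 : SColorable graph38 (oneTo 13) := by
  have h : ∀ u v : Fin 38, u ≠ v →
      Fin.ofNat 13 (colorTable.getD u 0) = Fin.ofNat 13 (colorTable.getD v 0) →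
      -- The `% 13` makes the radius agree definitionally with `oneTo 13` at the `Fin.ofNat` color.
      (ball (colorTable.getD u 0 % 13 + 1) u).testBit v = false := by
    decide +kernel
  refine ⟨fun v => Fin.ofNat 13 (colorTable.getD v 0), fun u _ v _ huv huv' => ?_⟩
  have := h u v huv huv'
  rw [← Bool.not_eq_true, testBit_ball, not_le] at this
  exact this

theorem not_sColorable_graph38 {j : ℕ} (hj : j < 13) : ¬ SColorable graph38 (oneTo j) := by
  rintro ⟨c, hc⟩
  have hsmall : (Finset.univ.filter fun v => (c v : ℕ) < 3).card ≤ 28 := by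
    refine card_le_of_isSPackingColoringOn _ (fun v => Fin.ofNat 3 (c v)) ?_
    intro u hu v hv huv huv'
    simp only [Finset.coe_filter, Finset.mem_univ, true_and, Set.mem_ofPred_eq] at hu hv
    have h1 := congrArg Fin.val huv'
    simp only [Fin.val_ofNat, Nat.mod_eq_of_lt hu, Nat.mod_eq_of_lt hv] at h1
    have := hc u trivial v trivial huv (Fin.ext h1)
    simpa only [oneTo, Fin.val_ofNat, Nat.mod_eq_of_lt hu] using this
  -- Indices from 3 on have value at least 4, the diameter, so none repeats; as `j < 13`, at most 9
  -- vertices get them, and 28 + 9 < 38.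
  have hlarge : (Finset.univ.filter fun v => ¬ (c v : ℕ) < 3).card ≤ (Finset.Ico 3 j).card := by
    refine Finset.card_le_card_of_injOn (fun v => (c v : ℕ)) ?_ ?_
    · intro v hv
      simp only [Finset.coe_filter, Finset.mem_univ, true_and, Set.mem_ofPred_eq] at hv
      exact Finset.mem_coe.2 (Finset.mem_Ico.2 ⟨not_lt.1 hv, (c v).2⟩)
    · intro u hu v hv huv
      simp only [Finset.coe_filter, Finset.mem_univ, true_and, Set.mem_ofPred_eq] at hu
      by_contra hne
      have h1 := (hc u trivial v trivial hne (Fin.ext huv)).trans_le (edist_graph38_le u v)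
      have h2 : (c u : ℕ) + 1 < 4 := by exact_mod_cast h1
      omega
  have := Finset.card_filter_add_card_filter_not (s := Finset.univ) fun v => (c v : ℕ) < 3
  rw [Finset.card_univ, Fintype.card_fin] at this
  rw [Nat.card_Ico] at hlarge
  omega

theorem packingChromaticNumber_graph38 : packingChromaticNumber graph38 = 13 :=
  (packingChromaticNumber_eq_iff graph38 13).2
    ⟨sColorable_graph38, fun _ hj => not_sColorable_graph38 hj⟩

end PackingColoring

theorem mainTheorem5 :
    ∃ G : SimpleGraph (Fin 38),
      PackingColoring.IsCubic G ∧ G.Connected ∧ G.ediam = 4 ∧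
      (∀ (A : Finset (Fin 38)) (c : Fin 38 → Fin 3),
        PackingColoring.IsSPackingColoringOn G (PackingColoring.oneTo 3) (A : Set (Fin 38)) c →
          A.card ≤ 28) ∧
      PackingColoring.packingChromaticNumber G = 13 :=
  ⟨PackingColoring.graph38, PackingColoring.isCubic_graph38, PackingColoring.connected_graph38,
    PackingColoring.ediam_graph38, PackingColoring.card_le_of_isSPackingColoringOn,
    PackingColoring.packingChromaticNumber_graph38⟩
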